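/- Let $T$ be a complete first-order theory in a language $L$; $x, y, y_i$ denote finite tuples of variables. A formula $\phi(x;y)$ is NIP if there is $n<\omega$ such that in no model of $T$ does $\phi$ shatter an $n$-element family, i.e. there are no tuples $(a_j)_{j<n}$, $(b_S)_{S\subseteq n}$ in a model of $T$ such that $\phi(a_j;b_S)$ holds iff $j\in S$. For a set $\Delta=\{\phi_i(x;y_i)\}_i$ of formulas and a model $N$ of $T$, a $\Delta$-type over $N$ is a maximal consistent set of formulas of the form $\phi_i(x;b)$ or $\neg\phi_i(x;b)$ with $b$ in $N$; the space $S_\Delta(N)$ of such types carries the topology generated by the sets of types that contain a given formula of this form. We write $\phi$ for $\Delta=\{\phi\}$, and $\mathrm{tp}_\Delta(a/N)$ for the $\Delta$-type of $a$ over $N$. If $M\prec\mathcal U$, a $\Delta$-type over $\mathcal U$ is finitely satisfiable in $M$ if each of its finite subsets is satisfied by a tuple of $M$. (1) A formula $\phi(x;y)$ is NIP if and only if for every model $M$ of $T$, every sequence $(p_i:i<\omega)$ in $S_\phi(M)$ has a subsequence which converges in $S_\phi(M)$. In (2) and (3), $M\prec\mathcal U$ are models of $T$, where $\mathcal U$ is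 any elementary extension of $M$ (for instance a monster model), and $q\in S_\Delta(\mathcal U)$ is finitely satisfiable in $M$. (2) If $M$ is countable and $\Delta=\{\phi_i(x;y_i)\}$ is a countable set of NIP formulas, then there is a sequence $(b_i:i<\omega)$ of tuples of $M$ such that $\lim_i \mathrm{tp}_\Delta(b_i/\mathcal U)=q$. (3) Let $\kappa>\aleph_0$ be a cardinal, let $S_{<\omega}(\kappa)$ be the set of finite subsets of $\kappa$, and let $\mathcal F$ be the filter on $S_{<\omega}(\kappa)$ generated by the sets $\{I : I\supseteq J\}$, $J\in S_{<\omega}(\kappa)$. If $|M|=\kappa$ and $\Delta=\{\phi_i(x;y_i)\}$ is a set of at most $\kappa$ NIP formulas, then there is a family $(b_l:l\in S_{<\omega}(\kappa))$ of tuples of $M$ such that $\lim_{\mathcal F}\mathrm{tp}_\Delta(b_l/\mathcal U)=q$. -/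

import Mathlib

open FirstOrder Cardinal Filter Topology

universe u v w w₁ w₂ w₃

namespace LocalTypes

variable {L : FirstOrder.Language.{u, v}}

/-- In the structure `N`, the formula `φ(x;y)` shatters some `n` tuples `a 0, …, a (n-1)`: every
subset `S` of the indices is cut out by an instance `φ(x; b S)` with `b S` in `N`. -/
def Shatters {α : Type w₁} {β : Type w₂} (φ : L.Formula (α ⊕ β)) (N : Type w) [L.Structure N]
    (n : ℕ) : Prop :=
  ∃ (a : Fin n → α → N) (b : Set (Fin n) → β → N),
    ∀ (i : Fin n) (S : Set (Fin n)), φ.Realize (Sum.elim (a i) (b S)) ↔ i ∈ S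

/-- The formula `φ(x;y)` is NIP modulo `T`: there is a finite bound on the size of the sets of
tuples that `φ` shatters in models of `T`. -/
def IsNIP (T : L.Theory) {α : Type w₁} {β : Type w₂} (φ : L.Formula (α ⊕ β)) : Prop :=
  ∃ n : ℕ, ∀ N : T.ModelType.{u, v, max u v}, ¬ Shatters φ N n

/-- A formula `φ_i(x;b)` (if `sign = true`) or `¬ φ_i(x;b)` (if `sign = false`), for a family
`(φ_i(x;y_i))_i` of formulas whose `y_i` is a tuple of variables indexed by `β i`, with `b` a tuple
of parameters in `N`. -/
structure SignedInstance {ι : Type w₃} (β : ι → Type w₂) (N : Type w) where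
  index : ι
  param : β index → N
  sign : Bool

section

variable {ι : Type w₃} {α : Type w₁} {β : ι → Type w₂} {N : Type w} [L.Structure N]

/-- The tuple `a` in `N` satisfies the signed instance `χ`. -/
def SignedInstance.Holds (Δ : ∀ i, L.Formula (α ⊕ β i)) (a : α → N) (χ : SignedInstance β N) :
    Prop :=
  (Δ χ.index).Realize (Sum.elim a χ.param) ↔ χ.sign = true

/-- Every finite subset of `p` is satisfied by a tuple in `A ⊆ N`. -/
def FinSatIn (Δ : ∀ i, L.Formula (α ⊕ β i)) (A : Set N) (p : Set (SignedInstance β N)) : Prop :=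
  ∀ s : Finset (SignedInstance β N), (s : Set (SignedInstance β N)) ⊆ p →
    ∃ a : α → N, (∀ j, a j ∈ A) ∧ ∀ χ ∈ s, χ.Holds Δ a

/-- A set of signed `Δ`-instances over `N` is consistent (with the elementary diagram of `N`) if it
is finitely satisfiable in `N`. -/
def Consistent (Δ : ∀ i, L.Formula (α ⊕ β i)) (p : Set (SignedInstance β N)) : Prop :=
  FinSatIn Δ Set.univ p

variable (N) in
/-- The space `S_Δ(N)` of `Δ`-types over the structure `N`: maximal consistent sets of formulas
`φ_i(x;b)`, `¬ φ_i(x;b)` with `b` in `N`. -/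
structure DeltaType (Δ : ∀ i, L.Formula (α ⊕ β i)) where
  carrier : Set (SignedInstance β N)
  isMaximal : Maximal (Consistent Δ) carrier

/-- The usual topology on `S_Δ(N)`, generated by the sets of types that contain a given signed
instance. -/
instance (Δ : ∀ i, L.Formula (α ⊕ β i)) : TopologicalSpace (DeltaType N Δ) :=
  TopologicalSpace.generateFrom
    (Set.range fun χ : SignedInstance β N => {p : DeltaType N Δ | χ ∈ p.carrier})

/-- The `Δ`-type `tp_Δ(a/N)` of a tuple `a` in `N`. -/
def tp (Δ : ∀ i, L.Formula (α ⊕ β i)) (a : α → N) : DeltaType N Δ where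
  carrier := {χ | χ.Holds Δ a}
  isMaximal := by
    refine ⟨fun s hs => ⟨a, fun _ => Set.mem_univ _, fun χ hχ => hs hχ⟩, ?_⟩
    intro q hq hle χ hχ
    by_contra hn
    have hflip : (⟨χ.index, χ.param, !χ.sign⟩ : SignedInstance β N) ∈ q := by
      apply hle
      simp only [Set.mem_ofPred_eq, SignedInstance.Holds] at hn ⊢
      cases h : χ.sign <;> simp_all
    classical
    obtain ⟨c, -, hc⟩ := hq {χ, ⟨χ.index, χ.param, !χ.sign⟩} (by
      intro ψ hψ
      simp only [Finset.coe_insert, Finset.coe_singleton, Set.mem_insert_iff,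
        Set.mem_singleton_iff] at hψ
      rcases hψ with rfl | rfl
      · exact hχ
      · exact hflip)
    have h1 := hc χ (by simp)
    have h2 := hc ⟨χ.index, χ.param, !χ.sign⟩ (by simp)
    simp only [SignedInstance.Holds] at h1 h2
    cases h : χ.sign <;> simp_all

end

end LocalTypes

/-! Finite satisfiability turns `q` into an ultrafilter on tuples of `M`; the rest is combinatorics
of an ultrafilter and of a family of sets `X c` shattering no `n` points. Call a list generic if its
elements are drawn successively from ultrafilter-large sets. If generic lists of length `2 * n` were
alternated by members of the family, `n` points would be shattered; so almost all such lists are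
alternated by no `X c` (`iteratedEventually_not_alternates`). In `exists_family_tendsto` each `b l`
is generic only over the finitely many lists drawn from `u l`. If `X c` gave the wrong answer at `b
l` frequently, wrong points `b l` and right generic points would interleave to an alternating
generic list, a contradiction. The index filter need only catch each point and each formula, which
covers (2) and (3) alike. For (1), the same result is applied to indices in `ℕ`. Conversely, a
formula that is not NIP shatters an infinite sequence in an ultraproduct, and the types of its terms
have no convergent subsequence. -/

namespace LocalTypes

/-! ### Ultrafilters and families of sets that shatter no large set -/

section Combinatorics

variable {A : Type*}

/-- The membership in `X` alternates along the list, the head being in `X` iff `s` holds. -/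
def Alternates (X : Set A) : Bool → List A → Prop
  | _, [] => True
  | s, a :: l => (a ∈ X ↔ s = true) ∧ Alternates X (!s) l

/-- Almost all ways (in the sense of the `k`-th iterate of `𝒰`) of extending the list by `k`
elements satisfy `P`. New elements are added at the head. -/
def IteratedEventually (𝒰 : Ultrafilter A) (P : List A → Prop) : ℕ → List A → Prop
  | 0, l => P l
  | k + 1, l => ∀ᶠ a in (𝒰 : Filter A), IteratedEventually 𝒰 P k (a :: l)

theorem iteratedEventually_not {𝒰 : Ultrafilter A} {P : List A → Prop} :
    ∀ {k : ℕ} {l : List A}, IteratedEventually 𝒰 (fun l => ¬ P l) k l ↔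
      ¬ IteratedEventually 𝒰 P k l
  | 0, _ => Iff.rfl
  | k + 1, l => by
    simp only [IteratedEventually, iteratedEventually_not, Ultrafilter.eventually_not]

/-- Each new element faces only the finitely many sublists already present, so one draw from the
ultrafilter keeps all of them generic at once. -/
theorem exists_list_forall_sublist {𝒰 : Ultrafilter A} {P : List A → Prop} {N : ℕ}
    (h : IteratedEventually 𝒰 P N []) (m : ℕ) :
    ∃ H : List A, H.length = m ∧
      ∀ l, l.Sublist H → ∀ k, l.length + k = N → IteratedEventually 𝒰 P k l := by
  induction m with
  | zero =>
    refine ⟨[], rfl, fun l hl k hk => ?_⟩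
    obtain rfl := List.sublist_nil.1 hl
    obtain rfl : k = N := by simpa using hk
    exact h
  | succ m ih =>
    obtain ⟨H, hH, hs⟩ := ih
    have key : ∀ᶠ a in (𝒰 : Filter A), ∀ l ∈ {l : List A | l.Sublist H}, ∀ k ∈ Set.Iio N,
        l.length + 1 + k = N → IteratedEventually 𝒰 P k (a :: l) := by
      have hfin : {l : List A | l.Sublist H}.Finite := by
        simp [← List.mem_sublists]
      refine (eventually_all_finite hfin).2 fun l hl =>
        (eventually_all_finite (Set.finite_Iio N)).2 fun k _ => ?_
      by_cases hk : l.length + 1 + k = N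
      · have := hs l hl (k + 1) (by omega)
        exact Eventually.mono this fun _ h _ => h
      · exact Eventually.of_forall fun _ h => absurd h hk
    obtain ⟨a, ha⟩ := key.exists
    refine ⟨a :: H, by simp [hH], fun l hl k hk => ?_⟩
    rcases List.sublist_cons_iff.1 hl with hl | ⟨r, rfl, hr⟩
    · exact hs l hl k hk
    · simp only [List.length_cons] at hk
      exact ha r hr k (show k < N by omega) hk

/-- Cut `H` into triples `x, y, z` and keep the middle points. Passing to `y, z` or to `x, y` gives
`y` either sign, and leaves the alternation after the triple unchanged. -/
theorem exists_shattered_of_alternates (s : Bool) (n : ℕ) :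
    ∀ H : List A, H.length = 3 * n → ∃ a : Fin n → A, ∀ S : Set (Fin n),
      ∃ l, l.Sublist H ∧ l.length = 2 * n ∧
        ∀ X : Set A, Alternates X s l → ∀ j, a j ∈ X ↔ j ∈ S := by
  induction n with
  | zero => exact fun H _ => ⟨Fin.elim0, fun S => ⟨[], by simp, rfl, fun _ _ j => j.elim0⟩⟩
  | succ n ih =>
    intro H hH
    match H, hH with
    | x :: y :: z :: H, hH =>
      obtain ⟨a, ha⟩ := ih H (by simp at hH; omega)
      refine ⟨Fin.cons y a, fun S => ?_⟩
      obtain ⟨l, hl, hlen, hX⟩ := ha (Fin.succ ⁻¹' S)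
      by_cases hS : ((0 : Fin (n + 1)) ∈ S ↔ s = true)
      · refine ⟨y :: z :: l, .cons _ ((hl.cons_cons z).cons_cons y), by simp [hlen]; omega,
          fun X h j => ?_⟩
        obtain ⟨h1, -, h2⟩ := h
        rw [Bool.not_not] at h2
        refine Fin.cases ?_ (fun j => ?_) j
        · simpa [hS] using h1
        · simpa using hX X h2 j
      · refine ⟨x :: y :: l, ((hl.cons z).cons_cons y).cons_cons x, by simp [hlen]; omega,
          fun X h j => ?_⟩
        obtain ⟨-, h1, h2⟩ := h
        rw [Bool.not_not] at h2
        refine Fin.cases ?_ (fun j => ?_) j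
        · simp only [Fin.cons_zero]
          rw [h1]
          cases s <;> simp_all
        · simpa using hX X h2 j

theorem iteratedEventually_not_alternates (𝒰 : Ultrafilter A) {C : Type*} {X : C → Set A} {n : ℕ}
    (hn : ¬ ∃ (a : Fin n → A) (c : Set (Fin n) → C), ∀ j S, a j ∈ X (c S) ↔ j ∈ S) (s : Bool) :
    IteratedEventually 𝒰 (fun l => ¬ ∃ c, Alternates (X c) s l) (2 * n) [] := by
  rw [iteratedEventually_not]
  intro h
  obtain ⟨H, hH, hs⟩ := exists_list_forall_sublist h (3 * n)
  obtain ⟨a, ha⟩ := exists_shattered_of_alternates s n H hH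
  choose l hl hlen hX using ha
  choose c hc using fun S => hs (l S) (hl S) 0 (hlen S)
  exact hn ⟨a, c, fun j S => hX S _ (hc S) j⟩

theorem finite_lists_of_length_le (u : Finset A) (N : ℕ) :
    {l : List A | l.length ≤ N ∧ ∀ a ∈ l, a ∈ u}.Finite := by
  refine ((List.finite_length_le u N).image (List.map Subtype.val)).subset ?_
  rintro l ⟨h1, h2⟩
  exact ⟨l.attach.map fun a => ⟨a.1, h2 _ a.2⟩, by simpa using h1, by simp⟩

/-- An ultrafilter on `A` is, with respect to families of sets that shatter no large subset of `A`,
the limit of a family of points of `A` that is indexed by any filter along which every element of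
`A` and every family is eventually taken into account. -/
theorem exists_family_tendsto {ι I : Type*} {C : ι → Type*} (X : ∀ i, C i → Set A)
    (hX : ∀ i, ∃ n : ℕ,
      ¬ ∃ (a : Fin n → A) (c : Set (Fin n) → C i), ∀ j S, a j ∈ X i (c S) ↔ j ∈ S)
    (𝒰 : Ultrafilter A) (F : Filter I) (u : I → Finset A) (hu : ∀ a, ∀ᶠ l in F, a ∈ u l)
    (v : I → Finset ι) (hv : ∀ i, ∀ᶠ l in F, i ∈ v l) (G : I → Set A) (hG : ∀ l, G l ∈ 𝒰) :
    ∃ b : I → A, (∀ l, b l ∈ G l) ∧ ∀ i c (s : Bool),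
      (∀ᶠ a in (𝒰 : Filter A), a ∈ X i c ↔ s = true) → ∀ᶠ l in F, b l ∈ X i c ↔ s = true := by
  choose n hn using hX
  let P (i : ι) (s : Bool) (l : List A) : Prop := ¬ ∃ c, Alternates (X i c) s l
  -- Each implication holds for almost all `b` by definition; the length bounds and the finite sets
  -- `u t`, `v t` leave finitely many of them.
  have hb (t : I) : ∃ b, b ∈ G t ∧ ∀ i ∈ v t, ∀ s : Bool,
      ∀ l ∈ {l : List A | l.length ≤ 2 * n i ∧ ∀ a ∈ l, a ∈ u t}, ∀ k ∈ Set.Iio (2 * n i),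
        IteratedEventually 𝒰 (P i s) (k + 1) l → IteratedEventually 𝒰 (P i s) k (b :: l) := by
    refine Eventually.exists (f := (𝒰 : Filter A)) (Eventually.and (hG t) ?_)
    refine (Finset.eventually_all _).2 fun i _ => eventually_all.2 fun s =>
      (eventually_all_finite (finite_lists_of_length_le _ _)).2 fun l _ =>
      (eventually_all_finite (Set.finite_Iio _)).2 fun k _ => ?_
    by_cases h : IteratedEventually 𝒰 (P i s) (k + 1) l
    · exact Eventually.mono h fun _ h _ => h
    · exact Eventually.of_forall fun _ h' => absurd h' h
  choose b hbG hb using hb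
  refine ⟨b, hbG, fun i c s hs => ?_⟩
  by_contra hcon
  rw [not_eventually] at hcon
  -- Each round adds a wrong point `b t`, then a right point from the ultrafilter, so genericity
  -- loses two pending draws and alternation gains two terms.
  have chain : ∀ k m, k + m = n i → ∃ l : List A, l.length = 2 * k ∧ Alternates (X i c) s l ∧
      IteratedEventually 𝒰 (P i s) (2 * m) l := by
    intro k
    induction k with
    | zero =>
      rintro m hm
      obtain rfl : m = n i := by omega
      exact ⟨[], rfl, trivial, iteratedEventually_not_alternates 𝒰 (hn i) s⟩
    | succ k ih =>
      intro m hm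
      obtain ⟨l, hlen, halt, hl⟩ := ih (m + 1) (by omega)
      have hul : ∀ᶠ t in F, ∀ a ∈ {a | a ∈ l}, a ∈ u t :=
        (eventually_all_finite l.finite_toSet).2 fun a _ => hu a
      obtain ⟨t, ht, htu, htv⟩ := (hcon.and_eventually (hul.and (hv i))).exists
      have h1 : IteratedEventually 𝒰 (P i s) (2 * m + 1) (b t :: l) :=
        hb t i htv s l ⟨by omega, htu⟩ (2 * m + 1) (show 2 * m + 1 < 2 * n i by omega) hl
      obtain ⟨a, ha, has⟩ := (Eventually.and h1 hs).exists
      refine ⟨a :: b t :: l, by simp [hlen]; omega, ⟨has, ?_, by simpa using halt⟩, ha⟩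
      cases s <;> simp_all
  obtain ⟨l, -, halt, hl⟩ := chain (n i) 0 rfl
  exact hl ⟨c, halt⟩

end Combinatorics

/-! ### Complete `Δ`-types, ultrafilters and convergence -/

section Types

variable {L : FirstOrder.Language.{u, v}} {ι : Type w₃} {α : Type w₁} {β : ι → Type w₂}
  {N : Type w} [L.Structure N] {Δ : ∀ i, L.Formula (α ⊕ β i)}

theorem holds_flip_iff {a : α → N} {i : ι} {c : β i → N} {s : Bool} :
    SignedInstance.Holds Δ a ⟨i, c, !s⟩ ↔ ¬ SignedInstance.Holds Δ a ⟨i, c, s⟩ := by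
  cases s <;> simp [SignedInstance.Holds]

theorem Consistent.not_mem_flip {p : Set (SignedInstance β N)} (hp : Consistent Δ p) {i : ι}
    {c : β i → N} {s : Bool} (h : ⟨i, c, s⟩ ∈ p) : (⟨i, c, !s⟩ : SignedInstance β N) ∉ p := by
  classical
  intro h'
  obtain ⟨a, -, ha⟩ := hp {⟨i, c, s⟩, ⟨i, c, !s⟩} (by simp [Set.insert_subset_iff, h, h'])
  exact holds_flip_iff.1 (ha ⟨i, c, !s⟩ (by simp)) (ha ⟨i, c, s⟩ (by simp))

theorem Consistent.maximal {p : Set (SignedInstance β N)} (hp : Consistent Δ p)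
    (h : ∀ i c s, ⟨i, c, s⟩ ∈ p ∨ ⟨i, c, !s⟩ ∈ p) : Maximal (Consistent Δ) p := by
  refine ⟨hp, fun q hq hle => ?_⟩
  rintro ⟨i, c, s⟩ hχ
  exact (h i c s).resolve_right fun h' => hq.not_mem_flip hχ (hle h')

theorem FinSatIn.exists_ultrafilter {B : Set N} {p : Set (SignedInstance β N)}
    (h : FinSatIn Δ B p) : ∃ 𝒰 : Ultrafilter (α → B), ∀ χ ∈ p,
      ∀ᶠ a in (𝒰 : Filter (α → B)), χ.Holds Δ (fun j => (a j : N)) := by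
  classical
  choose a haB ha using fun s : Finset p =>
    h (s.map (Function.Embedding.subtype _)) (by intro χ; simp; tauto)
  refine ⟨Ultrafilter.of (map (fun s j => ⟨a s j, haB s j⟩) atTop), fun χ hχ => ?_⟩
  refine Eventually.filter_mono (Ultrafilter.of_le _) (eventually_map.2 ?_)
  filter_upwards [eventually_ge_atTop {⟨χ, hχ⟩}] with s hs
  exact ha s χ (by simpa [hχ] using hs)

/-- An ultrafilter realizing `q` defines a consistent set that decides every instance and contains
`q`; by maximality it is contained in `q`. -/
theorem DeltaType.mem_carrier_or (q : DeltaType N Δ) (i : ι) (c : β i → N) (s : Bool) :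
    ⟨i, c, s⟩ ∈ q.carrier ∨ ⟨i, c, !s⟩ ∈ q.carrier := by
  obtain ⟨𝒰, h𝒰⟩ := q.isMaximal.prop.exists_ultrafilter
  have hcons : Consistent Δ {χ : SignedInstance β N |
      ∀ᶠ a in (𝒰 : Filter (α → (Set.univ : Set N))), χ.Holds Δ (fun j => (a j : N))} := fun t ht => by
    obtain ⟨a, ha⟩ := ((Finset.eventually_all t).2 fun χ hχ => ht hχ).exists
    exact ⟨_, fun _ => trivial, ha⟩
  have hle := q.isMaximal.le_of_ge hcons h𝒰
  have hor := Ultrafilter.eventually_or.1 (Eventually.of_forall (f := (𝒰 : Filter _))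
    fun a : α → (Set.univ : Set N) =>
      em (SignedInstance.Holds Δ (fun j => (a j : N)) ⟨i, c, s⟩))
  simp only [← holds_flip_iff] at hor
  exact hor.imp (fun h => hle h) fun h => hle h

theorem DeltaType.mem_carrier_iff (q : DeltaType N Δ) {i : ι} {c : β i → N} {s : Bool} :
    ⟨i, c, s⟩ ∈ q.carrier ↔ (⟨i, c, true⟩ ∈ q.carrier ↔ s = true) := by
  cases s
  · simpa using ⟨fun h => by simpa using q.isMaximal.prop.not_mem_flip h,
      fun h => (q.mem_carrier_or i c true).resolve_left h⟩
  · simp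

theorem DeltaType.tendsto_nhds_iff {I : Type*} {F : Filter I} {p : I → DeltaType N Δ}
    {q : DeltaType N Δ} :
    Tendsto p F (𝓝 q) ↔ ∀ χ ∈ q.carrier, ∀ᶠ l in F, χ ∈ (p l).carrier := by
  rw [TopologicalSpace.tendsto_nhds_generateFrom_iff, Set.forall_mem_range]
  rfl

/-- The limit of a family of `Δ`-types along an ultrafilter. -/
def ultralimit {I : Type*} (𝒰 : Ultrafilter I) (p : I → DeltaType N Δ) : DeltaType N Δ where
  carrier := {χ | ∀ᶠ l in (𝒰 : Filter I), χ ∈ (p l).carrier}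
  isMaximal := by
    refine Consistent.maximal (fun t ht => ?_) fun i c s => ?_
    · obtain ⟨l, hl⟩ := ((Finset.eventually_all t).2 fun χ hχ => ht hχ).exists
      exact (p l).isMaximal.prop t hl
    · exact Ultrafilter.eventually_or.1 (Eventually.of_forall fun l => (p l).mem_carrier_or i c s)

end Types

/-! ### NIP formulas, convergent subsequences and limits of realized types -/

section NIP

variable {L : FirstOrder.Language.{u, v}} {α : Type w₁} {β : Type w₂}

open Classical in
/-- The sentence that says that `φ` shatters some `n` tuples. -/
noncomputable def shatterSentence [Finite α] [Finite β] (φ : L.Formula (α ⊕ β)) (n : ℕ) :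
    L.Sentence :=
  let ψ (t : Fin n × Set (Fin n)) : L.Formula (Empty ⊕ ((Fin n × α) ⊕ (Set (Fin n) × β))) :=
    φ.relabel (Sum.elim (fun x => .inr (.inl (t.1, x))) fun y => .inr (.inr (t.2, y)))
  Language.Formula.iExs ((Fin n × α) ⊕ (Set (Fin n) × β))
    (Language.Formula.iInf fun t => if t.1 ∈ t.2 then ψ t else (ψ t).not)

theorem realize_shatterSentence [Finite α] [Finite β] {φ : L.Formula (α ⊕ β)} {n : ℕ} {N : Type w}
    [L.Structure N] : N ⊨ shatterSentence φ n ↔ Shatters φ N n := by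
  have key (g : (Fin n × α) ⊕ (Set (Fin n) × β) → N) (i : Fin n) (S : Set (Fin n)) :
      Sum.elim (default : Empty → N) g ∘ (Sum.elim (fun x => .inr (.inl (i, x)))
        fun y => .inr (.inr (S, y))) =
      Sum.elim (fun x => g (.inl (i, x))) fun y => g (.inr (S, y)) := by
    ext (_ | _) <;> rfl
  have lit (g : (Fin n × α) ⊕ (Set (Fin n) × β) → N) (i : Fin n) (S : Set (Fin n)) (P : Prop)
      [Decidable P] (ψ : L.Formula (Empty ⊕ ((Fin n × α) ⊕ (Set (Fin n) × β)))) :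
      (if P then ψ else ψ.not).Realize (Sum.elim default g) ↔
        (ψ.Realize (Sum.elim default g) ↔ P) := by
    split_ifs with h <;> simp [h]
  classical
  rw [shatterSentence, Language.Sentence.Realize, Language.Formula.realize_iExs]
  simp only [Language.Formula.realize_iInf]
  constructor
  · rintro ⟨g, hg⟩
    refine ⟨fun i x => g (.inl (i, x)), fun S y => g (.inr (S, y)), fun i S => ?_⟩
    have := (lit g i S _ _).1 (hg (i, S))
    rwa [Language.Formula.realize_relabel, key] at this
  · rintro ⟨a, b, h⟩
    refine ⟨Sum.elim (fun t => a t.1 t.2) fun t => b t.1 t.2, fun ⟨i, S⟩ => (lit _ i S _ _).2 ?_⟩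
    rw [Language.Formula.realize_relabel, key]
    exact h i S

/-- Shattering `n` tuples is a first-order sentence, so completeness carries the bound to models in
any universe. -/
theorem IsNIP.exists_not_shatters [Finite α] [Finite β] {T : L.Theory} (hT : T.IsComplete)
    {φ : L.Formula (α ⊕ β)} (h : IsNIP T φ) (U : Type w) [L.Structure U] [Nonempty U] [U ⊨ T] :
    ∃ n, ¬ Shatters φ U n := by
  obtain ⟨n, hn⟩ := h
  obtain ⟨N⟩ := hT.1
  refine ⟨n, fun hU => hn N ?_⟩
  rw [← realize_shatterSentence] at hU ⊢
  exact (hT.realize_sentence_iff _ N).2 ((hT.realize_sentence_iff _ U).1 hU)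

theorem IsNIP.exists_tendsto_subseq [Finite α] [Finite β] {T : L.Theory} (hT : T.IsComplete)
    {φ : L.Formula (α ⊕ β)} (h : IsNIP T φ) (M : Type w) [L.Structure M] [Nonempty M] [M ⊨ T]
    (p : ℕ → DeltaType M (fun _ : Unit => φ)) :
    ∃ f : ℕ → ℕ, StrictMono f ∧ ∃ q, Tendsto (fun n => p (f n)) atTop (𝓝 q) := by
  classical
  obtain ⟨n, hn⟩ := h.exists_not_shatters hT M
  have hX : ¬ ∃ (k : Fin n → ℕ) (c : Set (Fin n) → β → M),
      ∀ j S, k j ∈ {k | (⟨(), c S, true⟩ : SignedInstance (fun _ : Unit => β) M) ∈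
        (p k).carrier} ↔ j ∈ S := by
    rintro ⟨k, c, hkc⟩
    have hx (j : Fin n) : ∃ a : α → M, ∀ S, φ.Realize (Sum.elim a (c S)) ↔ j ∈ S := by
      obtain ⟨a, -, ha⟩ := (p (k j)).isMaximal.prop
        (Finset.univ.image fun S : Set (Fin n) => ⟨(), c S, decide (j ∈ S)⟩) (by
          intro χ hχ
          obtain ⟨S, -, rfl⟩ := Finset.mem_image.1 (Finset.mem_coe.1 hχ)
          exact (DeltaType.mem_carrier_iff _).2 (by simpa using hkc j S))
      refine ⟨a, fun S => ?_⟩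
      simpa [SignedInstance.Holds] using ha _ (Finset.mem_image_of_mem _ (Finset.mem_univ S))
    choose a ha using hx
    exact hn ⟨a, c, ha⟩
  let 𝒰 : Ultrafilter ℕ := hyperfilter ℕ
  -- The constraint `b l ≥ l` makes `b` tend to infinity, so a strictly increasing subsequence can
  -- be extracted.
  obtain ⟨b, hb, hconv⟩ := exists_family_tendsto (ι := Unit) (C := fun _ => β → M)
    (fun _ c => {k | ⟨(), c, true⟩ ∈ (p k).carrier}) (fun _ => ⟨n, hX⟩) 𝒰
    (atTop : Filter ℕ) Finset.range
    (fun a => (eventually_gt_atTop a).mono fun _ => Finset.mem_range.2)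
    (fun _ => Finset.univ) (by simp) (fun l => Set.Ici l)
    (fun l => (eventually_ge_atTop l).filter_mono Nat.hyperfilter_le_atTop)
  obtain ⟨f, hf, hbf⟩ := strictMono_subseq_of_tendsto_atTop (tendsto_atTop_mono hb tendsto_id)
  refine ⟨b ∘ f, hbf, ultralimit 𝒰 p, DeltaType.tendsto_nhds_iff.2 ?_⟩
  rintro ⟨⟨⟩, c, s⟩ hχ
  have h1 := hconv () c s (Eventually.mono hχ fun l hl => (DeltaType.mem_carrier_iff _).1 hl)
  exact (hf.tendsto_atTop.eventually h1).mono fun l hl => (DeltaType.mem_carrier_iff _).2 hl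

/-- A formula that is not NIP shatters an infinite sequence in some model. -/
theorem exists_model_shatters_sequence {T : L.Theory} {φ : L.Formula (α ⊕ β)}
    (h : ¬ IsNIP T φ) : ∃ (N : Language.Theory.ModelType.{u, v, max u v} T) (a : ℕ → α → N)
      (b : Set ℕ → β → N), ∀ i S, φ.Realize (Sum.elim (a i) (b S)) ↔ i ∈ S := by
  simp only [IsNIP, not_exists, not_forall, not_not] at h
  choose N a b hab using h
  let 𝒰 : Ultrafilter ℕ := hyperfilter ℕ
  have : ((𝒰 : Filter ℕ).Product fun n => N n) ⊨ T := (Language.Theory.model_iff _).2 fun ψ hψ =>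
    (Language.Ultraproduct.sentence_realize ψ).2
      (Eventually.of_forall fun n => Language.Theory.realize_sentence_of_mem T hψ)
  -- The arbitrary value occurs only for `n ≤ i`, a finite set that the nonprincipal ultrafilter
  -- ignores.
  let a' (i : ℕ) (x : α) (n : ℕ) : N n :=
    if h : i < n then a n ⟨i, h⟩ x else Classical.arbitrary _
  let b' (S : Set ℕ) (y : β) (n : ℕ) : N n := b n {j | (j : ℕ) ∈ S} y
  refine ⟨.of T ((𝒰 : Filter ℕ).Product fun n => N n), fun i x => (a' i x : (𝒰 : Filter ℕ).Product _),
    fun S y => (b' S y : (𝒰 : Filter ℕ).Product _), fun i S => ?_⟩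
  have h1 : (Sum.elim (fun x => (a' i x : (𝒰 : Filter ℕ).Product fun n => N n))
      fun y => (b' S y : (𝒰 : Filter ℕ).Product fun n => N n)) =
      fun z => ((Sum.elim (a' i) (b' S) : α ⊕ β → ∀ n, N n) z : (𝒰 : Filter ℕ).Product fun n => N n) := by
    ext (_ | _) <;> rfl
  have h2 : ∀ᶠ n in (𝒰 : Filter ℕ),
      (φ.Realize (fun z => Sum.elim (a' i) (b' S) z n) ↔ i ∈ S) := by
    filter_upwards [(eventually_gt_atTop i).filter_mono Nat.hyperfilter_le_atTop] with n hn
    have h3 : (fun z => Sum.elim (a' i) (b' S) z n) =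
        Sum.elim (a n ⟨i, hn⟩) (b n {j | (j : ℕ) ∈ S}) := by
      ext (_ | _) <;> simp [a', b', hn]
    rw [h3, hab]
    rfl
  change φ.Realize (Sum.elim (fun x => (a' i x : (𝒰 : Filter ℕ).Product fun n => N n))
      fun y => (b' S y : (𝒰 : Filter ℕ).Product fun n => N n)) ↔ i ∈ S
  rw [h1, Language.Ultraproduct.realize_formula_cast, eventually_congr h2]
  simp

theorem isNIP_of_forall_exists_tendsto_subseq {T : L.Theory} {φ : L.Formula (α ⊕ β)}
    (h : ∀ (M : Language.Theory.ModelType.{u, v, max u v w} T)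
      (p : ℕ → DeltaType M (fun _ : Unit => φ)),
      ∃ f : ℕ → ℕ, StrictMono f ∧ ∃ q, Tendsto (fun n => p (f n)) atTop (𝓝 q)) :
    IsNIP T φ := by
  by_contra hφ
  obtain ⟨N, a, b, hab⟩ := exists_model_shatters_sequence hφ
  let M : Language.Theory.ModelType.{u, v, max u v w} T :=
    Language.Theory.ModelType.ulift.{u, v, max u v, w} N
  let e : N ≃[L] M := Equiv.inducedStructureEquiv (Equiv.ulift.{w, max u v}.symm : N ≃ _)
  obtain ⟨f, hf, q, hq⟩ := h M fun n => tp (fun _ => φ) (e ∘ a n)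
  -- The instance at `b S` is true at the even terms of the subsequence and false at the odd ones,
  -- so neither sign is eventually constant.
  let S : Set ℕ := {n | ∃ k, n = f (2 * k)}
  have hS (n : ℕ) : f n ∈ S ↔ Even n := by
    simp only [S, Set.mem_ofPred_eq, hf.injective.eq_iff, even_iff_exists_two_mul]
  have hmem (n : ℕ) (s : Bool) : (⟨(), e ∘ b S, s⟩ : SignedInstance (fun _ : Unit => β) M) ∈
      (tp (fun _ => φ) (e ∘ a (f n))).carrier ↔ (Even n ↔ s = true) := by
    change (φ.Realize (Sum.elim (e ∘ a (f n)) (e ∘ b S)) ↔ s = true) ↔ _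
    rw [← Sum.comp_elim, Language.StrongHomClass.realize_formula, hab, hS]
  rw [DeltaType.tendsto_nhds_iff] at hq
  rcases q.mem_carrier_or () (e ∘ b S) true with h | h
  · obtain ⟨k, hk⟩ := (hq _ h).exists_forall_of_atTop
    simpa [Nat.even_add_one, (hmem k true).1 (hk k le_rfl)] using
      (hmem (k + 1) true).1 (hk _ (by omega))
  · obtain ⟨k, hk⟩ := (hq _ h).exists_forall_of_atTop
    simpa [Nat.even_add_one, (hmem k false).1 (hk k le_rfl)] using
      (hmem (k + 1) false).1 (hk _ (by omega))

theorem exists_family_tendsto_finSatIn {ι : Type w₃} {β : ι → Type w₂} [Finite α]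
    [∀ i, Finite (β i)] {T : L.Theory} (hT : T.IsComplete) {U : Type w} [L.Structure U]
    [Nonempty U] [U ⊨ T] {Δ : ∀ i, L.Formula (α ⊕ β i)} (hΔ : ∀ i, IsNIP T (Δ i)) {B : Set U}
    (q : DeltaType U Δ) (hq : FinSatIn Δ B q.carrier) {I : Type*} (F : Filter I)
    (u : I → Finset (α → B)) (hu : ∀ a, ∀ᶠ l in F, a ∈ u l)
    (v : I → Finset ι) (hv : ∀ i, ∀ᶠ l in F, i ∈ v l) :
    ∃ b : I → α → B, Tendsto (fun l => tp Δ (fun j => (b l j : U))) F (𝓝 q) := by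
  obtain ⟨𝒰, h𝒰⟩ := hq.exists_ultrafilter
  obtain ⟨b, -, hb⟩ := exists_family_tendsto (C := fun i => β i → U)
    (fun i c => {a : α → B | (Δ i).Realize (Sum.elim (fun j => (a j : U)) c)})
    (fun i => ((hΔ i).exists_not_shatters hT U).imp fun n hn ⟨a, c, h⟩ =>
      hn ⟨fun k j => a k j, c, h⟩) 𝒰 F u hu v hv (fun _ => Set.univ) (fun _ => univ_mem)
  refine ⟨b, DeltaType.tendsto_nhds_iff.2 ?_⟩
  rintro ⟨i, c, s⟩ hχ
  exact hb i c s (h𝒰 _ hχ)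

end NIP

/-! ### Indexing tuples and formulas; the theorem -/

/-- The finite sets of elements that an injection to an index type maps into a given finite set. -/
noncomputable def finsetComap {A K : Type*} (e : A ↪ K) (l : Finset K) : Finset A :=
  l.preimage e e.injective.injOn

theorem eventually_mem_finsetComap {A K : Type*} (e : A ↪ K) (a : A) :
    ∀ᶠ l in atTop, a ∈ finsetComap e l := by
  filter_upwards [eventually_ge_atTop {e a}] with l hl
  simpa [finsetComap] using hl

theorem nonempty_fun_embedding {α : Type w₁} {M K : Type w} [Finite α] [Infinite M]
    (h : #M = #K) : Nonempty ((α → M) ↪ K) := by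
  obtain ⟨n, ⟨e⟩⟩ := Finite.exists_equiv_fin α
  have : #(Fin n → M) ≤ #K := by
    rw [← h]
    simpa using Cardinal.power_nat_le (n := n) (Cardinal.aleph0_le_mk M)
  obtain ⟨g⟩ := Cardinal.le_def _ _ |>.1 this
  exact ⟨(e.arrowCongr (Equiv.refl M)).toEmbedding.trans g⟩

end LocalTypes

theorem mainTheorem11 {L : FirstOrder.Language.{u, v}} (T : L.Theory)
    (hT : T.IsComplete) :
    -- NIP is equivalent to the existence of converging subsequences
    (∀ (α : Type w₁) (β : Type w₂) [Finite α] [Finite β] (φ : L.Formula (α ⊕ β)),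
      LocalTypes.IsNIP T φ ↔
        ∀ (M : FirstOrder.Language.Theory.ModelType.{u, v, max u v w} T)
          (p : ℕ → LocalTypes.DeltaType M (fun _ : Unit => φ)),
          ∃ f : ℕ → ℕ, StrictMono f ∧ ∃ q, Tendsto (fun n => p (f n)) atTop (𝓝 q)) ∧
    -- countable models
    (∀ (U : Type w) [L.Structure U] [Nonempty U] [U ⊨ T] (M : L.ElementarySubstructure U)
      (α : Type w₁) (ι : Type w₃) (β : ι → Type w₂) [Finite α] [∀ i, Finite (β i)]
      (Δ : ∀ i, L.Formula (α ⊕ β i)),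
      Countable M → Countable ι → (∀ i, LocalTypes.IsNIP T (Δ i)) →
        ∀ q : LocalTypes.DeltaType U Δ, LocalTypes.FinSatIn Δ (M : Set U) q.carrier →
          ∃ b : ℕ → α → M,
            Tendsto (fun n => LocalTypes.tp Δ (fun j => (b n j : U))) atTop (𝓝 q)) ∧
    -- uncountable models: `atTop` on `Finset K` is the filter generated by the sets `{I | J ⊆ I}`
    (∀ (U : Type w) [L.Structure U] [Nonempty U] [U ⊨ T] (M : L.ElementarySubstructure U)
      (α : Type w₁) (ι : Type w₃) (β : ι → Type w₂) [Finite α] [∀ i, Finite (β i)]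
      (Δ : ∀ i, L.Formula (α ⊕ β i)) (κ : Cardinal.{w}),
      ℵ₀ < κ → #M = κ → Cardinal.lift.{w} #ι ≤ Cardinal.lift.{w₃} κ →
      (∀ i, LocalTypes.IsNIP T (Δ i)) →
        ∀ q : LocalTypes.DeltaType U Δ, LocalTypes.FinSatIn Δ (M : Set U) q.carrier →
          ∃ b : Finset κ.ord.ToType → α → M,
            Tendsto (fun l => LocalTypes.tp Δ (fun j => (b l j : U))) atTop (𝓝 q)) := by
  refine ⟨fun α β _ _ φ => ⟨fun h M p => h.exists_tendsto_subseq hT M p,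
    LocalTypes.isNIP_of_forall_exists_tendsto_subseq.{u, v, w}⟩, ?_, ?_⟩
  · intro U _ _ _ M α ι β _ _ Δ hM hι hΔ q hq
    have hM' : Countable (M : Set U) := hM
    obtain ⟨e, he⟩ := exists_injective_nat (α → (M : Set U))
    obtain ⟨e', he'⟩ := exists_injective_nat ι
    exact LocalTypes.exists_family_tendsto_finSatIn hT hΔ q hq atTop
      (fun n => LocalTypes.finsetComap ⟨e, he⟩ (Finset.range n))
      (fun a => tendsto_finset_range.eventually (LocalTypes.eventually_mem_finsetComap _ a))
      (fun n => LocalTypes.finsetComap ⟨e', he'⟩ (Finset.range n))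
      (fun a => tendsto_finset_range.eventually (LocalTypes.eventually_mem_finsetComap _ a))
  · intro U _ _ _ M α ι β _ _ Δ κ hκ hM hι hΔ q hq
    have hinf : Infinite (M : Set U) := Cardinal.infinite_iff.2 (hκ.le.trans hM.ge)
    -- The infinite set `M` has only `κ` finite tuples, so tuples and formulas both embed in the
    -- index type.
    have hMκ : #(M : Set U) = #κ.ord.ToType := by rw [Cardinal.mk_ord_toType]; exact hM
    obtain ⟨e⟩ := LocalTypes.nonempty_fun_embedding (α := α) hMκ
    obtain ⟨e'⟩ := Cardinal.lift_mk_le'.1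
      ((Cardinal.mk_ord_toType κ).symm ▸ hι :
        Cardinal.lift.{w} #ι ≤ Cardinal.lift.{w₃} #κ.ord.ToType)
    exact LocalTypes.exists_family_tendsto_finSatIn hT hΔ q hq atTop
      (LocalTypes.finsetComap e) (LocalTypes.eventually_mem_finsetComap e)
      (LocalTypes.finsetComap e') (LocalTypes.eventually_mem_finsetComap e')
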